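/- Conventions. Let $X$ be a metric space. For $x,y,z\in X$ write $x\preceq y\preceq z$ if $d(x,z)=d(x,y)+d(y,z)$, and say that $y$ is strictly between $x$ and $z$, written $x\prec y\prec z$, if moreover $x\neq y\neq z$. Put $[a,b]=\{x\in X: a\preceq x\preceq b\}$. The space $X$ is *aligned* if for all $n\ge 1$ and $x_0,\dots,x_n\in X$ with $x_{i-1}\prec x_i\prec x_{i+1}$ whenever $0<i<n$, one has $[x_0,x_n]=[x_0,x_1]\cup[x_1,x_2]\cup\dots\cup[x_{n-1},x_n]$. Two points are *adjacent* if they are distinct and no point is strictly between them; the *inner boundary* $\rho X$ is the set of points of $X$ that are adjacent to some point of $X$. For $n\ge 0$ and real $\ell\ge 0$, let $P_{n,\ell}(X)$ be the set of tuples $(x_0,\dots,x_n)\in X^{n+1}$ with $x_{i-1}\ne x_i$ for $1\le i\le n$ and length $d(x_0,x_1)+\dots+d(x_{n-1},x_n)=\ell$, and let $MC_{n,\ell}(X)=\mathbb{Z}P_{n,\ell}(X)$ be the free abelian group on it. The boundary map $\partial_n:MC_{n,\ell}(X)\to MC_{n-1,\ell}(X)$ ($n\ge 1$; $\partial_0=0$)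 is $\sum_{i=0}^n(-1)^i\partial_n^i$, where $\partial^i_n(x_0,\dots,x_n)$ is $(x_0,\dots,\widehat{x_i},\dots,x_n)$ if this tuple has length $\ell$, and $0$ otherwise. Put $MH_{n,\ell}(X)=\ker\partial_n/\operatorname{im}\partial_{n+1}$ and $MH_n(X)=\bigoplus_{\ell\ge 0}MH_{n,\ell}(X)$. A $1$-Lipschitz map $f:X\to Y$ induces a chain map sending a generator $(x_0,\dots,x_n)\in P_{n,\ell}(X)$ to $(f(x_0),\dots,f(x_n))$ if this tuple is in $P_{n,\ell}(Y)$, and to $0$ otherwise; write $f_*:MH_n(X)\to MH_n(Y)$ for the induced homomorphism. Theorem 6.6. Let $X$ and $Y$ be aligned metric spaces and let $f:X\to Y$ and $g:Y\to X$ be $1$-Lipschitz maps. The following are equivalent: 1. for all $n\ge 1$, the maps $f_*:MH_n(X)\to MH_n(Y)$ and $g_*:MH_n(Y)\to MH_n(X)$ are mutually inverse; 2. for some $n\ge 1$, the maps $f_*:MH_n(X)\to MH_n(Y)$ and $g_*:MH_n(Y)\to MH_n(X)$ are mutually inverse; 3. $f$ and $g$ restrict to mutually inverse isometries between $\rho X$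 and $\rho Y$. -/

import Mathlib

open scoped NNReal DirectSum

noncomputable section

namespace MagnitudeHomology

universe u v

/-! ## Betweenness, alignedness, inner boundary -/

/-- `y` is between `x` and `z`. -/
def IsBetween {X : Type u} [MetricSpace X] (x y z : X) : Prop :=
  dist x z = dist x y + dist y z

/-- `y` is strictly between `x` and `z`. -/
def StrictlyBetween {X : Type u} [MetricSpace X] (x y z : X) : Prop :=
  IsBetween x y z ∧ x ≠ y ∧ y ≠ z

/-- The closed interval `[a, b]` in a metric space. -/
def interval {X : Type u} [MetricSpace X] (a b : X) : Set X :=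
  {x | IsBetween a x b}

/-- A metric space is aligned if `[x₀, xₙ] = [x₀, x₁] ∪ ⋯ ∪ [xₙ₋₁, xₙ]` whenever `n ≥ 1` and each
interior point of the tuple `(x₀, …, xₙ)` is strictly between its two neighbours. (The tuple is
given as a sequence of which only the terms of index at most `n` matter.) -/
def Aligned (X : Type u) [MetricSpace X] : Prop :=
  ∀ n : ℕ, 1 ≤ n → ∀ x : ℕ → X,
    (∀ i, i + 1 < n → StrictlyBetween (x i) (x (i + 1)) (x (i + 2))) →
      interval (x 0) (x n) = ⋃ i ∈ Finset.range n, interval (x i) (x (i + 1))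

/-- Two points are adjacent if they are distinct and no point is strictly between them. -/
def Adjacent {X : Type u} [MetricSpace X] (x y : X) : Prop :=
  x ≠ y ∧ ∀ z, ¬ StrictlyBetween x z y

/-- The inner boundary `ρX`: the points adjacent to some point. -/
def innerBoundary (X : Type u) [MetricSpace X] : Set X :=
  {x | ∃ y, Adjacent x y}

/-! ## Proper chains -/

/-- The length `d(x₀, x₁) + ⋯ + d(xₙ₋₁, xₙ)` of a tuple. -/
def len {X : Type u} [MetricSpace X] {n : ℕ} (x : Fin (n + 1) → X) : ℝ :=
  ∑ i : Fin n, dist (x i.castSucc) (x i.succ)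

/-- The tuple `(x₀, …, xₙ)` is a proper chain: consecutive entries are distinct. -/
def IsProper {X : Type u} {n : ℕ} (x : Fin (n + 1) → X) : Prop :=
  ∀ i : Fin n, x i.castSucc ≠ x i.succ

/-- The set of proper chains of degree `n` and length `ℓ`. -/
def PC (n : ℕ) (ℓ : ℝ≥0) (X : Type u) [MetricSpace X] : Set (Fin (n + 1) → X) :=
  {x | IsProper x ∧ len x = ℓ}

lemma len_succ {X : Type u} [MetricSpace X] {n : ℕ} (x : Fin (n + 2) → X) :
    len x = dist (x 0) (x 1) + len (fun i => x i.succ) := by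
  simp only [len, Fin.sum_univ_succ (n := n)]
  rfl

lemma isProper_succ {X : Type u} {n : ℕ} (x : Fin (n + 2) → X) :
    IsProper x ↔ x 0 ≠ x 1 ∧ IsProper (fun i => x i.succ) := by
  simp only [IsProper, Fin.forall_fin_succ (n := n)]
  rfl

lemma len_nonneg {X : Type u} [MetricSpace X] {n : ℕ} (x : Fin (n + 1) → X) : 0 ≤ len x :=
  Finset.sum_nonneg fun _ _ => dist_nonneg

lemma face_aux {X : Type u} [MetricSpace X] : ∀ {n : ℕ} (x : Fin (n + 2) → X) (i : Fin (n + 2)),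
    len (i.removeNth x) ≤ len x ∧
      (IsProper x → len (i.removeNth x) = len x → IsProper (i.removeNth x))
  | 0, x, i => by
    refine ⟨?_, fun _ _ k => k.elim0⟩
    have : len (i.removeNth x) = 0 := by simp [len]
    rw [this]
    exact len_nonneg x
  | n + 1, x, i => by
    induction i using Fin.cases with
    | zero =>
      have h0 : (0 : Fin (n + 3)).removeNth x = fun i => x i.succ := by
        ext k; simp [Fin.removeNth]
      rw [h0, len_succ x, isProper_succ x]
      exact ⟨le_add_of_nonneg_left dist_nonneg, fun h _ => h.2⟩
    | succ j =>
      have hs : (fun k : Fin (n + 1) => j.succ.removeNth x k.succ)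
          = j.removeNth (fun k => x k.succ) := by
        ext k; simp [Fin.removeNth]
      have h0 : j.succ.removeNth x 0 = x 0 := by simp [Fin.removeNth]
      have h1 : j.succ.removeNth x 1 = j.removeNth (fun k => x k.succ) 0 := congrFun hs 0
      obtain ⟨ih1, ih2⟩ := face_aux (fun k => x k.succ) j
      rw [len_succ (j.succ.removeNth x), isProper_succ (j.succ.removeNth x), hs, h0, h1,
        len_succ x, isProper_succ x]
      induction j using Fin.cases with
      | zero =>
        have ht : (0 : Fin (n + 2)).removeNth (fun k => x k.succ) =
            fun k : Fin (n + 1) => x k.succ.succ := by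
          ext k; simp [Fin.removeNth]
        have h2 := len_succ (fun k : Fin (n + 2) => x k.succ)
        have h3 := isProper_succ (fun k : Fin (n + 2) => x k.succ)
        simp only [Fin.succ_zero_eq_one] at h2 h3
        rw [ht, h2, h3]
        have tri := dist_triangle (x 0) (x 1) (x (Fin.succ 1))
        refine ⟨?_, fun h e => ⟨?_, h.2.2⟩⟩
        · change dist (x 0) (x (Fin.succ 1)) + _ ≤ _
          linarith
        · change x 0 ≠ x (Fin.succ 1)
          change dist (x 0) (x (Fin.succ 1)) + _ = _ at e
          rw [← dist_pos]
          have := dist_pos.2 h.1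
          have := dist_nonneg (x := x 1) (y := x (Fin.succ 1))
          linarith
      | succ k =>
        have hk : k.succ.removeNth (fun k => x k.succ) 0 = x 1 := by simp [Fin.removeNth]
        rw [hk]
        exact ⟨by linarith, fun h e => ⟨h.1, ih2 h.2 (by linarith)⟩⟩

/-- Deleting an entry does not increase the length. -/
lemma len_face_le {X : Type u} [MetricSpace X] {n : ℕ} (x : Fin (n + 2) → X) (i : Fin (n + 2)) :
    len (i.removeNth x) ≤ len x :=
  (face_aux x i).1

/-- Deleting an entry of a proper chain without changing its length gives a proper chain. -/
lemma isProper_face {X : Type u} [MetricSpace X] {n : ℕ} (x : Fin (n + 2) → X)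
    (i : Fin (n + 2)) (hx : IsProper x) (h : len (i.removeNth x) = len x) :
    IsProper (i.removeNth x) :=
  (face_aux x i).2 hx h

lemma len_map_le {X : Type u} {Y : Type v} [MetricSpace X] [MetricSpace Y] {f : X → Y}
    (hf : LipschitzWith 1 f) {n : ℕ} (x : Fin (n + 1) → X) : len (f ∘ x) ≤ len x :=
  Finset.sum_le_sum fun _ _ => by simpa using hf.dist_le_mul _ _

lemma isProper_map {X : Type u} {Y : Type v} [MetricSpace X] [MetricSpace Y] {f : X → Y}
    (hf : LipschitzWith 1 f) {n : ℕ} (x : Fin (n + 1) → X) (hx : IsProper x)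
    (h : len (f ∘ x) = len x) : IsProper (f ∘ x) := by
  intro i
  have h1 := (Finset.sum_eq_sum_iff_of_le
    (fun (i : Fin n) _ => by simpa using hf.dist_le_mul (x i.castSucc) (x i.succ))).1 h i
      (Finset.mem_univ i)
  rw [← dist_pos]
  simp only [Function.comp_apply] at h1 ⊢
  rw [h1]
  exact dist_pos.2 (hx i)

/-! ## The magnitude chain complex -/

/-- The group of magnitude chains: the free abelian group on the proper chains of degree `n` and
length `ℓ`. -/
abbrev MC (n : ℕ) (ℓ : ℝ≥0) (X : Type u) [MetricSpace X] : Type u :=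
  PC n ℓ X →₀ ℤ

open Classical in
/-- The generator given by a tuple if that tuple is a proper chain of length `ℓ`, and `0`
otherwise. -/
def gen {n : ℕ} (ℓ : ℝ≥0) {X : Type u} [MetricSpace X] (x : Fin (n + 1) → X) : MC n ℓ X :=
  if h : x ∈ PC n ℓ X then Finsupp.single ⟨x, h⟩ 1 else 0

/-- The face map `∂ⁱ`: delete the `i`-th entry if the result has length `ℓ` (it is then
automatically proper, see `isProper_face`), and otherwise give `0`. -/
def face (n : ℕ) (ℓ : ℝ≥0) (X : Type u) [MetricSpace X] (i : Fin (n + 2)) :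
    MC (n + 1) ℓ X →ₗ[ℤ] MC n ℓ X :=
  Finsupp.linearCombination ℤ fun x => gen ℓ (i.removeNth x.1)

/-- The boundary map `∂ : MC (n + 1) ℓ X → MC n ℓ X`, the alternating sum of the face maps. -/
def boundary (n : ℕ) (ℓ : ℝ≥0) (X : Type u) [MetricSpace X] :
    MC (n + 1) ℓ X →ₗ[ℤ] MC n ℓ X :=
  ∑ i : Fin (n + 2), (-1 : ℤ) ^ (i : ℕ) • face n ℓ X i

/-- The chain map `f_#` induced by a function `f` in degree `n` and length `ℓ`. -/
def chainMap {X : Type u} {Y : Type v} [MetricSpace X] [MetricSpace Y] (f : X → Y)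
    (n : ℕ) (ℓ : ℝ≥0) : MC n ℓ X →ₗ[ℤ] MC n ℓ Y :=
  Finsupp.linearCombination ℤ fun x => gen ℓ (f ∘ x.1)

lemma gen_of_mem {n : ℕ} {ℓ : ℝ≥0} {X : Type u} [MetricSpace X] {x : Fin (n + 1) → X}
    (h : x ∈ PC n ℓ X) : gen ℓ x = Finsupp.single ⟨x, h⟩ 1 := dif_pos h

lemma gen_of_notMem {n : ℕ} {ℓ : ℝ≥0} {X : Type u} [MetricSpace X] {x : Fin (n + 1) → X}
    (h : x ∉ PC n ℓ X) : gen ℓ x = 0 := dif_neg h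

lemma gen_of_len_lt {n : ℕ} {ℓ : ℝ≥0} {X : Type u} [MetricSpace X] {x : Fin (n + 1) → X}
    (h : len x < ℓ) : gen ℓ x = 0 := gen_of_notMem fun hx => h.ne hx.2

/-- The tuples of length less than `ℓ`, or that are proper of length `ℓ`. -/
def Small {n : ℕ} (ℓ : ℝ≥0) {X : Type u} [MetricSpace X] (x : Fin (n + 1) → X) : Prop :=
  len x < ℓ ∨ x ∈ PC n ℓ X

lemma Small.face {n : ℕ} {ℓ : ℝ≥0} {X : Type u} [MetricSpace X] {x : Fin (n + 2) → X}
    (h : Small ℓ x) (i : Fin (n + 2)) : Small ℓ (i.removeNth x) := by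
  rcases h with h | h
  · exact Or.inl ((len_face_le x i).trans_lt h)
  · rcases (len_face_le x i).lt_or_eq with h1 | h1
    · exact Or.inl (h1.trans_eq h.2)
    · exact Or.inr ⟨isProper_face x i h.1 h1, h1.trans h.2⟩

lemma Small.map {X : Type u} {Y : Type v} [MetricSpace X] [MetricSpace Y] {f : X → Y}
    (hf : LipschitzWith 1 f) {n : ℕ} {ℓ : ℝ≥0} {x : Fin (n + 1) → X}
    (h : Small ℓ x) : Small ℓ (f ∘ x) := by
  rcases h with h | h
  · exact Or.inl ((len_map_le hf x).trans_lt h)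
  · rcases (len_map_le hf x).lt_or_eq with h1 | h1
    · exact Or.inl (h1.trans_eq h.2)
    · exact Or.inr ⟨isProper_map hf x h.1 h1, h1.trans h.2⟩

lemma face_gen {n : ℕ} {ℓ : ℝ≥0} {X : Type u} [MetricSpace X] {x : Fin (n + 2) → X}
    (h : Small ℓ x) (i : Fin (n + 2)) : face n ℓ X i (gen ℓ x) = gen ℓ (i.removeNth x) := by
  rcases h with h | h
  · rw [gen_of_len_lt h, gen_of_len_lt ((len_face_le x i).trans_lt h), map_zero]
  · rw [gen_of_mem h]
    simp [face]

lemma chainMap_gen {X : Type u} {Y : Type v} [MetricSpace X] [MetricSpace Y] {f : X → Y}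
    (hf : LipschitzWith 1 f) {n : ℕ} {ℓ : ℝ≥0} {x : Fin (n + 1) → X}
    (h : Small ℓ x) : chainMap f n ℓ (gen ℓ x) = gen ℓ (f ∘ x) := by
  rcases h with h | h
  · rw [gen_of_len_lt h, gen_of_len_lt ((len_map_le hf x).trans_lt h), map_zero]
  · rw [gen_of_mem h]
    simp [chainMap]

lemma boundary_gen {n : ℕ} {ℓ : ℝ≥0} {X : Type u} [MetricSpace X] {x : Fin (n + 2) → X}
    (h : Small ℓ x) : boundary n ℓ X (gen ℓ x) =
      ∑ i : Fin (n + 2), (-1 : ℤ) ^ (i : ℕ) • gen ℓ (i.removeNth x) := by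
  simp [boundary, LinearMap.sum_apply, face_gen h]

/-- `f_#` commutes with the boundary maps. -/
lemma boundary_chainMap {X : Type u} {Y : Type v} [MetricSpace X] [MetricSpace Y] {f : X → Y}
    (hf : LipschitzWith 1 f) (n : ℕ) (ℓ : ℝ≥0) (c : MC (n + 1) ℓ X) :
    boundary n ℓ Y (chainMap f (n + 1) ℓ c) = chainMap f n ℓ (boundary n ℓ X c) := by
  revert c
  refine LinearMap.congr_fun (f := boundary n ℓ Y ∘ₗ chainMap f (n + 1) ℓ)
    (g := chainMap f n ℓ ∘ₗ boundary n ℓ X) (Finsupp.lhom_ext' fun x => LinearMap.ext_ring ?_)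
  have hx : Small ℓ x.1 := Or.inr x.2
  have h1 : Finsupp.lsingle (R := ℤ) x (1 : ℤ) = gen ℓ x.1 := (gen_of_mem x.2).symm
  simp only [LinearMap.comp_apply, h1]
  rw [chainMap_gen hf hx, boundary_gen (hx.map hf), boundary_gen hx, map_sum]
  refine Finset.sum_congr rfl fun i _ => ?_
  rw [map_zsmul, chainMap_gen hf (hx.face i)]
  rfl

/-- The composite of two successive boundary maps is zero. -/
lemma boundary_boundary {X : Type u} [MetricSpace X] (n : ℕ) (ℓ : ℝ≥0) (c : MC (n + 2) ℓ X) :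
    boundary n ℓ X (boundary (n + 1) ℓ X c) = 0 := by
  revert c
  refine LinearMap.congr_fun (f := boundary n ℓ X ∘ₗ boundary (n + 1) ℓ X)
    (g := 0) (Finsupp.lhom_ext' fun x => LinearMap.ext_ring ?_)
  have hx : Small ℓ x.1 := Or.inr x.2
  have h1 : Finsupp.lsingle (R := ℤ) x (1 : ℤ) = gen ℓ x.1 := (gen_of_mem x.2).symm
  simp only [LinearMap.comp_apply, h1, LinearMap.zero_apply]
  rw [boundary_gen hx, map_sum]
  simp only [map_zsmul, boundary_gen (hx.face _), Finset.smul_sum, smul_smul, ← pow_add]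
  rw [← Fintype.sum_prod_type']
  refine Finset.sum_involution (fun p _ => (p.1.succAbove p.2, p.2.predAbove p.1)) ?_ ?_ ?_ ?_
  · rintro ⟨i, j⟩ -
    rw [Fin.neg_one_pow_succAbove_add_predAbove, ← Fin.removeNth_removeNth_eq_swap, neg_smul,
      add_neg_cancel]
  · rintro ⟨i, j⟩ - - h
    exact Fin.succAbove_ne i j (congrArg Prod.fst h)
  · exact fun _ _ => Finset.mem_univ _
  · rintro ⟨i, j⟩ -
    simp [Fin.succAbove_succAbove_predAbove, Fin.predAbove_predAbove_succAbove]

/-! ## Magnitude homology -/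

/-- The cycles in degree `n`: the kernel of the boundary map out of degree `n`, which is zero
if `n = 0`. -/
def cycles : (n : ℕ) → (ℓ : ℝ≥0) → (X : Type u) → [MetricSpace X] → Submodule ℤ (MC n ℓ X)
  | 0, _, _, _ => ⊤
  | n + 1, ℓ, X, _ => LinearMap.ker (boundary n ℓ X)

/-- The boundaries in degree `n`: the image of the boundary map out of degree `n + 1`. -/
def boundaries (n : ℕ) (ℓ : ℝ≥0) (X : Type u) [MetricSpace X] : Submodule ℤ (MC n ℓ X) :=
  LinearMap.range (boundary n ℓ X)

lemma boundaries_le_cycles (n : ℕ) (ℓ : ℝ≥0) (X : Type u) [MetricSpace X] :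
    boundaries n ℓ X ≤ cycles n ℓ X := by
  cases n with
  | zero => exact le_top
  | succ n =>
    rintro _ ⟨c, rfl⟩
    exact boundary_boundary n ℓ c

/-- The magnitude homology group in degree `n` and length `ℓ`: cycles modulo boundaries. -/
abbrev MHl (n : ℕ) (ℓ : ℝ≥0) (X : Type u) [MetricSpace X] : Type u :=
  cycles n ℓ X ⧸ (boundaries n ℓ X).submoduleOf (cycles n ℓ X)

lemma chainMap_mem_cycles {X : Type u} {Y : Type v} [MetricSpace X] [MetricSpace Y] {f : X → Y}
    (hf : LipschitzWith 1 f) (n : ℕ) (ℓ : ℝ≥0) (c : MC n ℓ X) (hc : c ∈ cycles n ℓ X) :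
    chainMap f n ℓ c ∈ cycles n ℓ Y := by
  cases n with
  | zero => trivial
  | succ n =>
    change boundary n ℓ Y (chainMap f (n + 1) ℓ c) = 0
    rw [boundary_chainMap hf, show boundary n ℓ X c = 0 from hc, map_zero]

lemma chainMap_mem_boundaries {X : Type u} {Y : Type v} [MetricSpace X] [MetricSpace Y]
    {f : X → Y} (hf : LipschitzWith 1 f) (n : ℕ) (ℓ : ℝ≥0) (c : MC n ℓ X)
    (hc : c ∈ boundaries n ℓ X) : chainMap f n ℓ c ∈ boundaries n ℓ Y := by
  obtain ⟨b, rfl⟩ := hc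
  exact ⟨chainMap f (n + 1) ℓ b, boundary_chainMap hf n ℓ b⟩

/-- The map `f_*` on magnitude homology in degree `n` and length `ℓ`, induced by `f_#`. -/
def mapl {X : Type u} {Y : Type v} [MetricSpace X] [MetricSpace Y] (f : X → Y)
    (hf : LipschitzWith 1 f) (n : ℕ) (ℓ : ℝ≥0) : MHl n ℓ X →ₗ[ℤ] MHl n ℓ Y :=
  Submodule.mapQ _ _ ((chainMap f n ℓ).restrict (chainMap_mem_cycles hf n ℓ))
    fun c hc => chainMap_mem_boundaries hf n ℓ c.1 hc

/-- The magnitude homology group in degree `n`, the direct sum over all lengths. -/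
abbrev MH (n : ℕ) (X : Type u) [MetricSpace X] : Type u :=
  ⨁ ℓ : ℝ≥0, MHl n ℓ X

/-- The map `f_*` on magnitude homology in degree `n`. -/
def map {X : Type u} {Y : Type v} [MetricSpace X] [MetricSpace Y] (f : X → Y)
    (hf : LipschitzWith 1 f) (n : ℕ) : MH n X →ₗ[ℤ] MH n Y :=
  DirectSum.lmap fun ℓ => mapl f hf n ℓ

end MagnitudeHomology

end

open scoped NNReal DirectSum

noncomputable section

namespace MagnitudeHomology

universe u v

/-! ### Betweenness -/

section Betweenness

variable {X : Type u} [MetricSpace X] {a b c d e m : X}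

/-! Call a proper chain thin if consecutive entries are adjacent and no entry is strictly between
its neighbours. In an aligned space, homology in degree $n\ge 1$ is free on the thin chains. A
boundary term deletes an entry strictly between its neighbours. Such a deletion neither applies to a
thin chain (`Thin.not_deletion`) nor produces one (`Deletion.not_thin`), so thin chains span a
summand with zero differential. The other summand is contractible (`Aligned.bdry_htpy`). Cut a chain
into maximal runs, whose interior entries are strictly between their neighbours. A non-thin chain
has a first run with non-adjacent ends; choose a point $m$ strictly between these ends and insert it
where it fits. By alignedness deletions do not move the ends of runs, so a chain and its faces use
the same $m$, and insertion is a contracting homotopy. For $n\ge 1$ thin chains have all entries in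
the inner boundary, and each point of the inner boundary starts a thin chain $a,b,a,\dots$ in every
degree. Hence $g_*f_*=\mathrm{id}$ in one degree forces $gf=\mathrm{id}$ on $\rho X$, which in turn
gives $g_*f_*=\mathrm{id}$ in all degrees $n\ge 1$. -/

lemma StrictlyBetween.left_ne_right (h : StrictlyBetween a b c) : a ≠ c := by
  rintro rfl
  have h1 := h.1
  have := dist_pos.2 h.2.1
  have := dist_nonneg (x := b) (y := a)
  rw [IsBetween, dist_self] at h1
  linarith

lemma not_strictlyBetween_self (a b : X) : ¬ StrictlyBetween a b a :=
  fun h => h.left_ne_right rfl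

/-- Two triangle inequalities suffice, in any metric space; only the converse, `Aligned.concat`,
needs alignedness. -/
lemma StrictlyBetween.inner_right (h : StrictlyBetween a b c) (h' : StrictlyBetween a c d) :
    StrictlyBetween b c d ∧ StrictlyBetween a b d := by
  obtain ⟨h1, h2, h3⟩ := h
  obtain ⟨h1', h2', h3'⟩ := h'
  unfold IsBetween at h1 h1'
  have t1 := dist_triangle a b d
  have t2 := dist_triangle b c d
  have hbd : StrictlyBetween b c d := ⟨by unfold IsBetween; linarith, h3, h3'⟩
  exact ⟨hbd, by unfold IsBetween; linarith, h2, hbd.left_ne_right⟩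

lemma StrictlyBetween.inner_left (h : StrictlyBetween b c d) (h' : StrictlyBetween a b d) :
    StrictlyBetween a b c ∧ StrictlyBetween a c d := by
  obtain ⟨h1, h2, h3⟩ := h
  obtain ⟨h1', h2', h3'⟩ := h'
  unfold IsBetween at h1 h1'
  have t1 := dist_triangle a b c
  have t2 := dist_triangle a c d
  have hac : StrictlyBetween a b c := ⟨by unfold IsBetween; linarith, h2', h2⟩
  exact ⟨hac, by unfold IsBetween; linarith, hac.left_ne_right, h3⟩

lemma Aligned.mem_interval_or (hX : Aligned X) (h : StrictlyBetween a b c)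
    (hm : IsBetween a m c) : IsBetween a m b ∨ IsBetween b m c := by
  have := hX 2 (by norm_num) (fun i => match i with | 0 => a | 1 => b | _ => c) (by
    intro i hi
    obtain rfl : i = 0 := by omega
    exact h)
  have hm' := this.subset (show m ∈ interval a c from hm)
  simp only [Set.mem_iUnion, Finset.mem_range] at hm'
  obtain ⟨i, hi, hmi⟩ := hm'
  interval_cases i
  exacts [Or.inl hmi, Or.inr hmi]

/-- Alignedness for four points: $b$ and $c$ lie in $[b,c]\subseteq[a,d]$. This and the three-point
case `Aligned.mem_interval_or` are all that is used of alignedness. -/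
lemma Aligned.concat (hX : Aligned X) (h : StrictlyBetween a b c) (h' : StrictlyBetween b c d) :
    StrictlyBetween a b d ∧ StrictlyBetween a c d := by
  have := hX 3 (by norm_num) (fun i => match i with | 0 => a | 1 => b | 2 => c | _ => d) (by
    intro i hi
    obtain rfl | rfl : i = 0 ∨ i = 1 := by omega
    exacts [h, h'])
  have hbc : b ∈ interval b c ∧ c ∈ interval b c := by simp [interval, IsBetween]
  have key : interval b c ⊆ interval a d := by
    intro z hz
    refine this.ge ?_
    simp only [Set.mem_iUnion, Finset.mem_range]
    exact ⟨1, by norm_num, hz⟩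
  exact ⟨⟨key hbc.1, h.2.1, h'.left_ne_right⟩, ⟨key hbc.2, h.left_ne_right, h'.2.2⟩⟩

/-- Deleting $b$ from $a,b,c,d$ does not affect whether $c$ is strictly between its neighbours.
`Aligned.iff_of_right` is the mirror image. -/
lemma Aligned.iff_of_left (hX : Aligned X) (h : StrictlyBetween a b c) :
    StrictlyBetween b c d ↔ StrictlyBetween a c d :=
  ⟨fun h' => (hX.concat h h').2, fun h' => (h.inner_right h').1⟩

lemma Aligned.iff_of_right (hX : Aligned X) (h : StrictlyBetween b c d) :
    StrictlyBetween a b c ↔ StrictlyBetween a b d :=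
  ⟨fun h' => (hX.concat h' h).1, fun h' => (h.inner_left h').1⟩

lemma Aligned.right_half (hX : Aligned X) (h : StrictlyBetween a b c)
    (hm : StrictlyBetween a m c) (hmb : m ≠ b) (hn : ¬ StrictlyBetween a m b) :
    StrictlyBetween b m c :=
  (hX.mem_interval_or h hm.1).elim (fun h1 => (hn ⟨h1, hm.2.1, hmb⟩).elim)
    fun h1 => ⟨h1, hmb.symm, hm.2.2⟩

end Betweenness

/-! ### Chains with a fixed first entry, as lists -/

section Lists

open Finsupp

variable {X : Type u}

/-- Prepend an entry. -/
def consL (b : X) : (List X →₀ ℤ) →ₗ[ℤ] (List X →₀ ℤ) := lmapDomain ℤ ℤ (List.cons b)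

@[simp] lemma consL_single (b : X) (L : List X) (k : ℤ) :
    consL b (single L k) = single (b :: L) k := by
  simp [consL]

lemma consL_mem_supported {b : X} {Y : List X →₀ ℤ} {S S' : Set (List X)}
    (h : ∀ T ∈ S, b :: T ∈ S') (hY : Y ∈ supported ℤ ℤ S) : consL b Y ∈ supported ℤ ℤ S' := by
  have : lmapDomain ℤ ℤ (List.cons b) Y ∈ (supported ℤ ℤ S).map (lmapDomain ℤ ℤ (List.cons b)) :=
    Submodule.mem_map_of_mem hY
  rw [lmapDomain_supported] at this
  exact supported_mono (Set.image_subset_iff.2 h) this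

lemma eqOn_supported {M : Type*} [AddCommGroup M] [Module ℤ M] {f g : (List X →₀ ℤ) →ₗ[ℤ] M}
    {S : Set (List X)} (h : ∀ T ∈ S, f (single T 1) = g (single T 1)) {Y : List X →₀ ℤ}
    (hY : Y ∈ supported ℤ ℤ S) : f Y = g Y := by
  rw [supported_eq_span_single] at hY
  refine LinearMap.eqOn_span (f := f) (g := g) ?_ hY
  rintro _ ⟨T, hT, rfl⟩
  exact h T hT

variable [MetricSpace X]

open Classical in
/-- The projection to the lists whose head `c` has `b` strictly between `a` and `c`. -/
def smoothProj (a b : X) : (List X →₀ ℤ) →ₗ[ℤ] (List X →₀ ℤ) :=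
  linearCombination ℤ fun
    | [] => 0
    | c :: L => if StrictlyBetween a b c then single (c :: L) 1 else 0

open Classical in
lemma smoothProj_consL (a b c : X) (Y : List X →₀ ℤ) :
    smoothProj a b (consL c Y) = if StrictlyBetween a b c then consL c Y else 0 := by
  induction Y using Finsupp.induction_linear with
  | zero => simp
  | add f g hf hg => split_ifs at * <;> simp_all
  | single L k =>
    simp only [smoothProj, consL_single, linearCombination_single]
    split_ifs <;> simp

/-- The boundary of `a :: L`, with the first entry `a` left out. -/
def bdryAux : X → List X → (List X →₀ ℤ)
  | _, [] => 0
  -- Deleting $b$ is face 1, hence the sign; later faces are those of `b :: L` with the index raised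
  -- by one. Deleting an end of a proper chain shortens it and contributes nothing.
  | a, b :: L => -smoothProj a b (single L 1) - consL b (bdryAux b L)

/-- The linear extension of `bdryAux`. -/
def bdryL (a : X) : (List X →₀ ℤ) →ₗ[ℤ] (List X →₀ ℤ) := linearCombination ℤ (bdryAux a)

@[simp] lemma bdryL_single (a : X) (L : List X) : bdryL a (single L 1) = bdryAux a L := by
  simp [bdryL]

lemma bdryL_consL (a b : X) (Y : List X →₀ ℤ) :
    bdryL a (consL b Y) = -smoothProj a b Y - consL b (bdryL b Y) := by
  have : bdryL a ∘ₗ consL b = -smoothProj a b - consL b ∘ₗ bdryL b := by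
    ext L : 2
    simp [bdryAux]
  exact LinearMap.congr_fun this Y

open Classical in
/-- Insert `m` into `a :: L` at the place where it fits (with a sign), with the first entry `a`
left out. -/
def insAux (m : X) : X → List X → (List X →₀ ℤ)
  | _, [] => 0
  | a, b :: L =>
    -- The sign is $(-1)^i$ for insertion at index $i$. If $m$ is already an entry of the run, the
    -- value is 0.
    if StrictlyBetween a m b then -single (m :: b :: L) 1
    else if m = b then 0 else -consL b (insAux m b L)

/-- The linear extension of `insAux`. -/
def insL (m a : X) : (List X →₀ ℤ) →ₗ[ℤ] (List X →₀ ℤ) := linearCombination ℤ (insAux m a)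

@[simp] lemma insL_single (m a : X) (L : List X) : insL m a (single L 1) = insAux m a L := by
  simp [insL]

open Classical in
lemma insL_consL (m a b : X) (Y : List X →₀ ℤ) :
    insL m a (consL b Y) = if StrictlyBetween a m b then -consL m (consL b Y)
      else if m = b then 0 else -consL b (insL m b Y) := by
  have : insL m a ∘ₗ consL b = if StrictlyBetween a m b then -(consL m ∘ₗ consL b)
      else if m = b then 0 else -(consL b ∘ₗ insL m b) := by
    split_ifs with h1 h2
    · ext L : 2; simp [insAux, h1]
    · ext L : 2; simp [insAux, if_neg h1, if_pos h2]
    · ext L : 2; simp [insAux, h1, h2]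
  have := LinearMap.congr_fun this Y
  split_ifs at * <;> exact this

/-! ### Runs and their invariance under deletion -/

open Classical in
/-- The last entry of the longest initial run of `a :: b :: L` whose interior entries are strictly
between their neighbours. -/
def runEnd : X → X → List X → X
  | _, b, [] => b
  | a, b, c :: L => if StrictlyBetween a b c then runEnd b c L else b

lemma runEnd_cons_of_smooth {a b c : X} {L : List X} (h : StrictlyBetween a b c) :
    runEnd a b (c :: L) = runEnd b c L := by simp [runEnd, h]

lemma runEnd_cons_of_not {a b c : X} {L : List X} (h : ¬ StrictlyBetween a b c) :
    runEnd a b (c :: L) = b := by simp [runEnd, h]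

lemma Aligned.runEnd_eq_or (hX : Aligned X) (L : List X) : ∀ (a b : X),
    runEnd a b L = b ∨ StrictlyBetween a b (runEnd a b L) := by
  induction L with
  | nil => exact fun _ _ => Or.inl rfl
  | cons c L ih =>
    intro a b
    by_cases h : StrictlyBetween a b c
    · rw [runEnd_cons_of_smooth h]
      rcases ih b c with h' | h'
      · rw [h']; exact Or.inr h
      · exact Or.inr (hX.concat h h').1
    · rw [runEnd_cons_of_not h]; exact Or.inl rfl

/-- `Deletion a L T`: the list `a :: T` arises from `a :: L` by deleting an entry that is strictly
between its neighbours. -/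
inductive Deletion : X → List X → List X → Prop
  | here {a b c : X} (h : StrictlyBetween a b c) (L : List X) : Deletion a (b :: c :: L) (c :: L)
  | there {a b : X} {L T : List X} (h : Deletion b L T) : Deletion a (b :: L) (b :: T)

/-- A deletion keeps a list nonempty and does not change which entries in front of it are strictly
between their neighbours. -/
lemma Aligned.deletion_head (hX : Aligned X) {b : X} {L T : List X} (h : Deletion b L T) :
    ∃ c L' c' T', L = c :: L' ∧ T = c' :: T' ∧
      ∀ a, StrictlyBetween a b c ↔ StrictlyBetween a b c' := by
  cases h with
  | here h L => exact ⟨_, _, _, _, rfl, rfl, fun a => hX.iff_of_right h⟩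
  | there h => exact ⟨_, _, _, _, rfl, rfl, fun a => Iff.rfl⟩

lemma Aligned.runEnd_skip (hX : Aligned X) {a b c : X} (h : StrictlyBetween a b c) (L : List X) :
    runEnd b c L = runEnd a c L := by
  cases L with
  | nil => rfl
  | cons d L =>
    by_cases hd : StrictlyBetween b c d
    · rw [runEnd_cons_of_smooth hd, runEnd_cons_of_smooth ((hX.iff_of_left h).1 hd)]
    · rw [runEnd_cons_of_not hd, runEnd_cons_of_not (mt (hX.iff_of_left h).2 hd)]

/-- A deleted entry is interior to a run, and the status of its neighbours is unchanged, so the ends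
of runs survive. -/
lemma Aligned.runEnd_cons_congr (hX : Aligned X) {b : X} {L T : List X} (h : Deletion b L T) :
    ∀ a, runEnd a b L = runEnd a b T := by
  induction h with
  | here h L =>
    intro a
    rename_i b c d
    by_cases hd : StrictlyBetween a b c
    · rw [runEnd_cons_of_smooth hd, runEnd_cons_of_smooth ((hX.iff_of_right h).1 hd),
        runEnd_cons_of_smooth h, hX.runEnd_skip h]
    · rw [runEnd_cons_of_not hd, runEnd_cons_of_not (mt (hX.iff_of_right h).2 hd)]
  | there h ih =>
    intro a
    simp only [runEnd, ih]

lemma Aligned.runEnd_congr (hX : Aligned X) {a b c : X} {L T : List X}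
    (h : Deletion a (b :: L) (c :: T)) : runEnd a b L = runEnd a c T := by
  cases h with
  | here h L => rw [runEnd_cons_of_smooth h, hX.runEnd_skip h]
  | there h => exact hX.runEnd_cons_congr h a

lemma bdryAux_mem (L : List X) : ∀ a, bdryAux a L ∈ supported ℤ ℤ {T | Deletion a L T} := by
  induction L with
  | nil => exact fun _ => Submodule.zero_mem _
  | cons b L ih =>
    intro a
    refine Submodule.sub_mem _ (Submodule.neg_mem _ ?_)
      (consL_mem_supported (fun T hT => Deletion.there hT) (ih b))
    cases L with
    | nil => simp [smoothProj]
    | cons c L =>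
      rw [← consL_single, smoothProj_consL]
      split_ifs with h
      · rw [consL_single]
        exact single_mem_supported ℤ _ (Deletion.here h L)
      · exact Submodule.zero_mem _

lemma insAux_mem (m : X) (L : List X) :
    ∀ a, insAux m a L ∈ supported ℤ ℤ {T | Deletion a T L} := by
  induction L with
  | nil => exact fun _ => Submodule.zero_mem _
  | cons b L ih =>
    intro a
    unfold insAux
    split_ifs with h1 h2
    · exact Submodule.neg_mem _ (single_mem_supported ℤ _ (Deletion.here h1 L))
    · exact Submodule.zero_mem _
    · exact Submodule.neg_mem _ (consL_mem_supported (fun T hT => Deletion.there hT) (ih b))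

/-- Inserting an entry of the first run is a contracting homotopy. -/
lemma Aligned.bdry_ins (hX : Aligned X) (m : X) (L : List X) : ∀ a b,
    StrictlyBetween a m (runEnd a b L) →
      bdryL a (insAux m a (b :: L)) + insL m a (bdryAux a (b :: L)) = single (b :: L) 1 := by
  induction L with
  | nil =>
    intro a b h
    simp only [runEnd] at h
    have h0 : smoothProj a b (single [] 1) = 0 := by simp [smoothProj]
    have h1 : smoothProj m b (single [] 1) = 0 := by simp [smoothProj]
    have h2 : smoothProj a m (single [b] 1) = single [b] 1 := by
      rw [← consL_single, smoothProj_consL, if_pos h]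
    simp [insAux, if_pos h, bdryAux, h0, h1, h2]
  | cons c L ih =>
    intro a b h
    have hb : bdryAux a (b :: c :: L) = -smoothProj a b (single (c :: L) 1)
      - consL b (bdryAux b (c :: L)) := rfl
    -- Here $m$ goes directly after $a$. Deleting $m$ again returns the chain; all other terms
    -- cancel against insertions into the faces.
    by_cases h1 : StrictlyBetween a m b
    · have h3 := hX.iff_of_left (d := c) h1
      rw [hb, map_sub, map_neg, insL_consL, if_pos h1]
      simp only [insAux, if_pos h1, map_neg, bdryL_single]
      simp only [bdryAux, ← consL_single, smoothProj_consL, if_pos h1]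
      by_cases h2 : StrictlyBetween a b c
      · have h4 := (h1.inner_right h2).2
        simp only [if_pos h2, if_pos (h3.2 h2), insL_consL, if_pos h4, map_neg, map_sub]
        abel
      · simp only [if_neg h2, if_neg (mt h3.1 h2), map_zero, map_neg, map_sub]
        abel
    · have h2 : StrictlyBetween a b c := by
        by_contra h2
        rw [runEnd_cons_of_not h2] at h
        exact h1 h
      rw [runEnd_cons_of_smooth h2] at h
      have hs : smoothProj a b (single (c :: L) 1) = single (c :: L) 1 := by
        rw [← consL_single, smoothProj_consL, if_pos h2]
      rw [hb, hs, map_sub, map_neg, insL_consL, if_neg h1, insL_single]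
      -- If $m=b$, insertion gives 0, and the chain is recovered by deleting $b$ and inserting it
      -- again.
      by_cases h3 : m = b
      · subst h3
        simp [insAux, h1, h2]
      · have h4 : StrictlyBetween a b (runEnd b c L) := by
          rcases hX.runEnd_eq_or L b c with h' | h'
          · rwa [h']
          · exact (hX.concat h2 h').1
        have ih' := ih b c (hX.right_half h4 h h3 h1)
        have h5 : insAux m a (b :: c :: L) = -consL b (insAux m b (c :: L)) := by
          rw [insAux, if_neg h1, if_neg h3]
        have h6 : StrictlyBetween a m c ↔ StrictlyBetween b m c :=
          ⟨fun h' => hX.right_half h2 h' h3 h1, fun h' => (h'.inner_left h2).2⟩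
        -- With $m$ further right, deleting $b$ commutes with inserting $m$. These terms cancel,
        -- leaving the induction hypothesis with $b$ prepended.
        have h7 : smoothProj a b (insAux m b (c :: L)) = insAux m a (c :: L) := by
          by_cases h8 : StrictlyBetween b m c
          · rw [insAux, insAux, if_pos h8, if_pos (h6.2 h8), map_neg, ← consL_single,
              smoothProj_consL, if_pos (h8.inner_left h2).1]
          · rw [insAux, insAux, if_neg h8, if_neg (mt h6.1 h8)]
            split_ifs with h9
            · simp
            · rw [map_neg, smoothProj_consL, if_pos h2]
        rw [if_neg h3, h5, map_neg, bdryL_consL, h7, ← consL_single b, ← ih', map_add]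
        abel

/-! ### The contracting homotopy and thin lists -/

open Classical in
/-- The contracting homotopy: insert an entry into the first run whose ends are not adjacent. -/
def htpyAux : X → List X → (List X →₀ ℤ)
  | _, [] => 0
  | a, b :: L =>
    if h : ∃ m, StrictlyBetween a m (runEnd a b L) then insAux h.choose a (b :: L)
    -- In an aligned space such a run is the single step from $a$ to $b$, so the next run starts at
    -- $b$.
    else -consL b (htpyAux b L)

/-- The inserted point depends only on the ends $a$ and $e$, so lists with equal run ends share it.
-/
lemma htpyAux_cons_of_exists {a b e : X} {L : List X} (h : ∃ m, StrictlyBetween a m e)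
    (he : runEnd a b L = e) : htpyAux a (b :: L) = insAux h.choose a (b :: L) := by
  subst he
  rw [htpyAux, dif_pos h]

lemma htpyAux_cons_of_not {a b : X} {L : List X}
    (h : ¬ ∃ m, StrictlyBetween a m (runEnd a b L)) :
    htpyAux a (b :: L) = -consL b (htpyAux b L) := by
  rw [htpyAux, dif_neg h]

/-- The linear extension of `htpyAux`. -/
def htpyL (a : X) : (List X →₀ ℤ) →ₗ[ℤ] (List X →₀ ℤ) := linearCombination ℤ (htpyAux a)

@[simp] lemma htpyL_single (a : X) (L : List X) : htpyL a (single L 1) = htpyAux a L := by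
  simp [htpyL]

lemma htpyAux_mem (L : List X) :
    ∀ a, htpyAux a L ∈ supported ℤ ℤ {T | Deletion a T L} := by
  induction L with
  | nil => exact fun _ => Submodule.zero_mem _
  | cons b L ih =>
    intro a
    unfold htpyAux
    split_ifs with h
    · exact insAux_mem _ _ _
    · exact Submodule.neg_mem _ (consL_mem_supported (fun T hT => Deletion.there hT) (ih b))

/-- `Thin a L`: in the list `a :: L`, no point is strictly between consecutive entries, and no
entry is strictly between its neighbours. -/
def Thin : X → List X → Prop
  | _, [] => True
  | a, b :: L => (∀ z, ¬ StrictlyBetween a z b) ∧ (∀ c ∈ L.head?, ¬ StrictlyBetween a b c) ∧ Thin b L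

lemma Deletion.not_thin {a : X} {L T : List X} (h : Deletion a L T) : ¬ Thin a T := by
  induction h with
  | here h L => exact fun h' => h'.1 _ h
  | there h ih => exact fun h' => ih h'.2.2

lemma Thin.not_deletion {L : List X} : ∀ {a : X}, Thin a L → ∀ T, ¬ Deletion a L T := by
  induction L with
  | nil => intro a _ T h; cases h
  | cons b L ih =>
    intro a ha T h
    cases h with
    | here h L => exact ha.2.1 _ rfl h
    | there h => exact ih ha.2.2 _ h

lemma Thin.bdryAux_eq_zero {a : X} {L : List X} (h : Thin a L) : bdryAux a L = 0 := by
  have := bdryAux_mem L a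
  rwa [show {T | Deletion a L T} = ∅ from Set.eq_empty_of_forall_notMem h.not_deletion,
    supported_empty, Submodule.mem_bot] at this

/-- If the first run has room, all faces share its ends, and `Aligned.bdry_ins` applies. Otherwise
it is one step, and the identity is inherited from the tail, which is again not thin. -/
lemma Aligned.bdry_htpy (hX : Aligned X) (L : List X) : ∀ a, ¬ Thin a L →
    bdryL a (htpyAux a L) + htpyL a (bdryAux a L) = single L 1 := by
  induction L with
  | nil => exact fun a h => (h trivial).elim
  | cons b L ih =>
    intro a hT
    by_cases h : ∃ m, StrictlyBetween a m (runEnd a b L)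
    · have h1 : htpyL a (bdryAux a (b :: L)) = insL h.choose a (bdryAux a (b :: L)) := by
        refine eqOn_supported (fun T hT => ?_) (bdryAux_mem (b :: L) a)
        obtain ⟨_, _, c, T, h1, rfl, -⟩ := hX.deletion_head hT
        have h2 := hX.runEnd_congr hT
        rw [htpyL_single, insL_single, htpyAux_cons_of_exists h h2.symm]
      rw [h1, htpyAux_cons_of_exists h rfl]
      exact hX.bdry_ins _ L a b h.choose_spec
    · have hE : runEnd a b L = b := (hX.runEnd_eq_or L a b).resolve_right fun h' => h ⟨_, h'⟩
      have hs : ∀ c ∈ L.head?, ¬ StrictlyBetween a b c := by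
        intro c hc h'
        obtain ⟨L, rfl⟩ : ∃ L', L = c :: L' := ⟨L.tail, List.eq_cons_of_mem_head? hc⟩
        rw [runEnd_cons_of_smooth h'] at h hE
        rcases hX.runEnd_eq_or L b c with h2 | h2
        · exact h'.2.2 (hE.symm.trans h2)
        · exact h2.left_ne_right hE.symm
      have hT' : ¬ Thin b L := fun h' => hT ⟨fun z hz => h ⟨z, hE.symm ▸ hz⟩, hs, h'⟩
      have h1 : htpyL a (consL b (bdryAux b L)) = -consL b (htpyL b (bdryAux b L)) := by
        refine eqOn_supported (f := htpyL a ∘ₗ consL b) (g := -(consL b ∘ₗ htpyL b))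
          (fun T hT => ?_) (bdryAux_mem L b)
        have h2 := hX.runEnd_cons_congr hT a
        simp only [LinearMap.comp_apply, consL_single, htpyL_single, LinearMap.neg_apply]
        exact htpyAux_cons_of_not (h2 ▸ h)
      -- Insertions after $b$ do not make $b$ strictly between its neighbours.
      have h2 : smoothProj a b (htpyAux b L) = 0 := by
        refine eqOn_supported (f := smoothProj a b) (g := 0) (fun T hT => ?_) (htpyAux_mem L b)
        obtain ⟨c, L', c', T', rfl, rfl, h3⟩ := hX.deletion_head hT
        rw [← consL_single, smoothProj_consL, if_neg, LinearMap.zero_apply]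
        exact fun h' => hs _ rfl ((h3 a).1 h')
      have h3 : smoothProj a b (single L 1) = 0 := by
        cases L with
        | nil => simp [smoothProj]
        | cons c L => rw [← consL_single, smoothProj_consL, if_neg (hs _ rfl)]
      rw [htpyAux_cons_of_not h, bdryAux, map_neg, bdryL_consL, h2, h3, ← consL_single b, ← ih b hT',
        map_add, map_sub, h1]
      simp

end Lists

/-! ### Chains as lists -/

section FullLists

open Finsupp

variable {X : Type u}

lemma isProper_iff_isChain : ∀ {n : ℕ} (x : Fin (n + 1) → X),
    IsProper x ↔ List.IsChain (· ≠ ·) (List.ofFn x)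
  | 0, x => by simp [IsProper]
  | n + 1, x => by
    rw [isProper_succ, isProper_iff_isChain, List.ofFn_succ (f := x), List.ofFn_succ,
      List.isChain_cons_cons]
    rfl

lemma exists_tuple {n : ℕ} (a : X) (L : List X) (h : L.length = n) :
    ∃ x : Fin (n + 1) → X, x 0 = a ∧ (List.ofFn fun i => x i.succ) = L := by
  subst h
  exact ⟨Fin.cons a L.get, rfl, by simp⟩

/-- The alternating list `b, a, b, …` with `n` entries. -/
def alternating : ℕ → X → X → List X
  | 0, _, _ => []
  | n + 1, a, b => b :: alternating n b a

lemma length_alternating (n : ℕ) : ∀ a b : X, (alternating n a b).length = n := by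
  induction n with
  | zero => exact fun _ _ => rfl
  | succ n ih => intro a b; simp [alternating, ih]

variable [MetricSpace X]

/-- The boundary operator on lists. -/
def listBdry : (List X →₀ ℤ) →ₗ[ℤ] (List X →₀ ℤ) :=
  linearCombination ℤ fun
    | [] => 0
    | a :: L => consL a (bdryAux a L)

/-- The contracting homotopy on lists. -/
def listHtpy : (List X →₀ ℤ) →ₗ[ℤ] (List X →₀ ℤ) :=
  linearCombination ℤ fun
    | [] => 0
    | a :: L => consL a (htpyAux a L)

@[simp] lemma listBdry_single (a : X) (L : List X) :
    listBdry (single (a :: L) 1) = consL a (bdryAux a L) := by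
  simp [listBdry]

@[simp] lemma listHtpy_single (a : X) (L : List X) :
    listHtpy (single (a :: L) 1) = consL a (htpyAux a L) := by
  simp [listHtpy]

lemma listBdry_consL (a : X) (Y : List X →₀ ℤ) : listBdry (consL a Y) = consL a (bdryL a Y) := by
  have : listBdry ∘ₗ consL a = consL a ∘ₗ bdryL a := by ext L : 2; simp
  exact LinearMap.congr_fun this Y

lemma listHtpy_consL (a : X) (Y : List X →₀ ℤ) : listHtpy (consL a Y) = consL a (htpyL a Y) := by
  have : listHtpy ∘ₗ consL a = consL a ∘ₗ htpyL a := by ext L : 2; simp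
  exact LinearMap.congr_fun this Y

lemma Aligned.listBdry_listHtpy (hX : Aligned X) {Y : List X →₀ ℤ}
    (hY : Y ∈ supported ℤ ℤ {T | ∃ a L, T = a :: L ∧ ¬ Thin a L}) :
    listBdry (listHtpy Y) + listHtpy (listBdry Y) = Y := by
  refine eqOn_supported (f := listBdry ∘ₗ listHtpy + listHtpy ∘ₗ listBdry) (g := LinearMap.id)
    ?_ hY
  rintro _ ⟨a, L, rfl, h⟩
  simp only [LinearMap.add_apply, LinearMap.comp_apply, listBdry_single, listHtpy_single,
    listBdry_consL, listHtpy_consL, ← map_add, hX.bdry_htpy L a h, consL_single,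
    LinearMap.id_apply]

/-- The length of the chain `a :: L`. -/
def pathLen : X → List X → ℝ
  | _, [] => 0
  | a, b :: L => dist a b + pathLen b L

lemma Deletion.length_eq {a : X} {L T : List X} (h : Deletion a L T) :
    L.length = T.length + 1 := by
  induction h with
  | here => rfl
  | there h ih => simp [ih]

lemma Deletion.pathLen_eq {a : X} {L T : List X} (h : Deletion a L T) :
    pathLen a L = pathLen a T := by
  induction h with
  | here h L =>
    have := h.1
    simp only [IsBetween] at this
    simp only [pathLen]
    linarith
  | there h ih => simp [pathLen, ih]

lemma Deletion.isChain {a : X} {L T : List X} (h : Deletion a L T)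
    (hT : List.IsChain (· ≠ ·) (a :: T)) : List.IsChain (· ≠ ·) (a :: L) := by
  induction h with
  | here h L =>
    rw [List.isChain_cons_cons] at hT ⊢
    rw [List.isChain_cons_cons]
    exact ⟨h.2.1, h.2.2, hT.2⟩
  | there h ih =>
    rw [List.isChain_cons_cons] at hT ⊢
    exact ⟨hT.1, ih hT.2⟩

lemma len_eq_pathLen : ∀ {n : ℕ} (x : Fin (n + 1) → X),
    len x = pathLen (x 0) (List.ofFn fun i => x i.succ)
  | 0, x => by simp [len, pathLen]
  | n + 1, x => by
    rw [len_succ, len_eq_pathLen, List.ofFn_succ (f := fun i : Fin (n + 1) => x i.succ)]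
    rfl

lemma mem_PC_iff {n : ℕ} {ℓ : ℝ≥0} (x : Fin (n + 1) → X) : x ∈ PC n ℓ X ↔
    List.IsChain (· ≠ ·) (x 0 :: List.ofFn fun i => x i.succ) ∧
      pathLen (x 0) (List.ofFn fun i => x i.succ) = ℓ := by
  rw [← len_eq_pathLen, ← List.ofFn_succ, ← isProper_iff_isChain]
  rfl

/-- The embedding of magnitude chains into formal sums of lists. -/
def toLists (n : ℕ) (ℓ : ℝ≥0) (X : Type u) [MetricSpace X] : MC n ℓ X →ₗ[ℤ] (List X →₀ ℤ) :=
  lmapDomain ℤ ℤ fun x => List.ofFn x.1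

lemma toLists_injective (n : ℕ) (ℓ : ℝ≥0) : Function.Injective (toLists n ℓ X) :=
  mapDomain_injective (List.ofFn_injective.comp Subtype.val_injective)

lemma toLists_gen {n : ℕ} {ℓ : ℝ≥0} {x : Fin (n + 1) → X} (h : x ∈ PC n ℓ X) :
    toLists n ℓ X (gen ℓ x) = single (List.ofFn x) 1 := by
  rw [gen_of_mem h]
  simp [toLists]

open Classical in
/-- The list given by a face of a tuple, if that has the same length, and `0` otherwise. -/
def listFace {n : ℕ} (x : Fin (n + 2) → X) (i : Fin (n + 2)) : List X →₀ ℤ :=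
  if len (i.removeNth x) = len x then single (List.ofFn (i.removeNth x)) 1 else 0

lemma toLists_gen_removeNth {n : ℕ} {ℓ : ℝ≥0} {x : Fin (n + 2) → X} (h : x ∈ PC (n + 1) ℓ X)
    (i : Fin (n + 2)) : toLists n ℓ X (gen ℓ (i.removeNth x)) = listFace x i := by
  unfold listFace
  split_ifs with h1
  · exact toLists_gen ⟨isProper_face x i h.1 h1, h1.trans h.2⟩
  · rw [gen_of_notMem, map_zero]
    exact fun h2 => h1 (h2.2.trans h.2.symm)

lemma listFace_zero {n : ℕ} {x : Fin (n + 2) → X} (h : IsProper x) : listFace x 0 = 0 := by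
  refine if_neg ?_
  rw [len_succ x, show (0 : Fin (n + 2)).removeNth x = fun i => x i.succ by
    ext k; simp [Fin.removeNth]]
  have := dist_pos.2 ((isProper_succ x).1 h).1
  linarith

open Classical in
lemma listFace_one {n : ℕ} {x : Fin (n + 3) → X} (h : IsProper x) :
    listFace x 1 =
      consL (x 0) (smoothProj (x 0) (x 1) (single (List.ofFn fun i => x i.succ.succ) 1)) := by
  have h0 : (1 : Fin (n + 3)).removeNth x = Fin.cons (x 0) fun i => x i.succ.succ := by
    ext k
    induction k using Fin.cases with
    | zero => simp [Fin.removeNth]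
    | succ k =>
      have : (1 : Fin (n + 3)).succAbove k.succ = k.succ.succ := Fin.succ_succAbove_succ 0 k
      simp [Fin.removeNth, this]
  have h1 := (isProper_succ x).1 h
  have h2 := ((isProper_succ _).1 h1.2).1
  have h3 : len ((1 : Fin (n + 3)).removeNth x) = len x ↔
      StrictlyBetween (x 0) (x 1) (x (Fin.succ 1)) := by
    rw [h0, len_succ, len_succ x, len_succ fun i => x i.succ]
    simp only [Fin.cons_zero, Fin.cons_succ, Fin.succ_zero_eq_one]
    change dist (x 0) (x (Fin.succ 1)) + _ = _ ↔ _
    constructor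
    · intro h
      exact ⟨by unfold IsBetween; linarith, h1.1, h2⟩
    · intro h
      have := h.1
      unfold IsBetween at this
      linarith
  rw [List.ofFn_succ, ← consL_single, smoothProj_consL]
  change _ = consL (x 0) (if StrictlyBetween (x 0) (x 1) (x (Fin.succ 1)) then
    consL (x (Fin.succ 1)) (single (List.ofFn fun i => x i.succ.succ.succ) 1) else 0)
  unfold listFace
  by_cases h4 : StrictlyBetween (x 0) (x 1) (x (Fin.succ 1))
  · rw [if_pos (h3.2 h4), if_pos h4, h0, List.ofFn_succ, List.ofFn_succ]
    simp
  · rw [if_neg (mt h3.1 h4), if_neg h4, map_zero]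

lemma listFace_succ_succ {n : ℕ} (x : Fin (n + 3) → X) (j : Fin (n + 1)) :
    listFace x j.succ.succ = consL (x 0) (listFace (fun i => x i.succ) j.succ) := by
  have h0 : j.succ.succ.removeNth x = Fin.cons (x 0) (j.succ.removeNth fun i => x i.succ) := by
    ext k
    induction k using Fin.cases with
    | zero => simp [Fin.removeNth]
    | succ k => simp [Fin.removeNth]
  have h1 : (j.succ.removeNth fun i => x i.succ) 0 = x 1 := by simp [Fin.removeNth]
  have h3 : len (j.succ.succ.removeNth x) = len x ↔
      len (j.succ.removeNth fun i => x i.succ) = len fun i => x i.succ := by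
    rw [h0, len_succ, len_succ x]
    simp only [Fin.cons_succ]
    rw [Fin.cons_zero, ← Fin.succ_zero_eq_one, Fin.cons_succ, h1]
    exact add_right_inj _
  unfold listFace
  by_cases h4 : len (j.succ.removeNth fun i => x i.succ) = len fun i => x i.succ
  · rw [if_pos (h3.2 h4), if_pos h4, h0, List.ofFn_succ, consL_single]
    simp
  · rw [if_neg (mt h3.1 h4), if_neg h4, map_zero]

/-- The end faces vanish, face 1 is the `smoothProj` term, and the other faces come from the tail
with the index shifted, which flips their sign. -/
lemma sum_listFace : ∀ {n : ℕ} {x : Fin (n + 2) → X} (_ : IsProper x),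
    ∑ i : Fin (n + 2), (-1 : ℤ) ^ (i : ℕ) • listFace x i =
      consL (x 0) (bdryAux (x 0) (List.ofFn fun i => x i.succ))
  | 0, x, h => by
    have h1 : listFace x 1 = 0 := by
      refine if_neg ?_
      rw [len_succ x]
      simp [len, ((isProper_succ x).1 h).1]
    rw [Fin.sum_univ_two, listFace_zero h, h1]
    simp [bdryAux, smoothProj]
  | n + 1, x, h => by
    have ih := sum_listFace ((isProper_succ x).1 h).2
    rw [Fin.sum_univ_succ, listFace_zero ((isProper_succ x).1 h).2] at ih
    rw [Fin.sum_univ_succ, Fin.sum_univ_succ, listFace_zero h, Fin.succ_zero_eq_one,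
      listFace_one h]
    simp only [listFace_succ_succ, ← map_zsmul, ← map_sum]
    rw [List.ofFn_succ (f := fun i : Fin (n + 2) => x i.succ), bdryAux]
    simp only [Fin.val_succ, pow_succ _ (_ + 1), mul_neg, mul_one, neg_smul, Finset.sum_neg_distrib,
      Fin.val_zero, pow_zero, zero_add, smul_zero, map_sub, map_neg] at ih ⊢
    rw [ih]
    simp [sub_eq_add_neg]

lemma toLists_boundary (n : ℕ) (ℓ : ℝ≥0) (c : MC (n + 1) ℓ X) :
    toLists n ℓ X (boundary n ℓ X c) = listBdry (toLists (n + 1) ℓ X c) := by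
  revert c
  refine LinearMap.congr_fun (f := toLists n ℓ X ∘ₗ boundary n ℓ X)
    (g := listBdry ∘ₗ toLists (n + 1) ℓ X) (Finsupp.lhom_ext' fun x => LinearMap.ext_ring ?_)
  have h1 : Finsupp.lsingle (R := ℤ) x (1 : ℤ) = gen ℓ x.1 := (gen_of_mem x.2).symm
  simp only [LinearMap.comp_apply, h1]
  rw [boundary_gen (Or.inr x.2), map_sum, toLists_gen x.2, List.ofFn_succ, listBdry_single,
    ← sum_listFace x.2.1]
  simp only [map_zsmul, toLists_gen_removeNth x.2]

/-- Inserting a strictly intermediate point preserves length and properness, so the homotopy on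
lists restricts to magnitude chains. -/
lemma listHtpy_toLists_mem (n : ℕ) (ℓ : ℝ≥0) (c : MC n ℓ X) :
    listHtpy (toLists n ℓ X c) ∈ LinearMap.range (toLists (n + 1) ℓ X) := by
  induction c using Finsupp.induction_linear with
  | zero => simp
  | add f g hf hg => rw [map_add, map_add]; exact Submodule.add_mem _ hf hg
  | single x k =>
    have h1 : (single x k : MC n ℓ X) = k • gen ℓ x.1 := by rw [gen_of_mem x.2]; simp
    rw [h1, map_zsmul, map_zsmul]
    refine Submodule.smul_mem _ _ ?_
    rw [toLists_gen x.2, List.ofFn_succ, listHtpy_single]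
    have h2 := htpyAux_mem (List.ofFn fun i => x.1 i.succ) (x.1 0)
    have h3 : consL (x.1 0) (htpyAux (x.1 0) (List.ofFn fun i => x.1 i.succ)) ∈
        supported ℤ ℤ {T | ∃ L, T = x.1 0 :: L ∧
          Deletion (x.1 0) L (List.ofFn fun i => x.1 i.succ)} :=
      consL_mem_supported (fun T hT => ⟨T, rfl, hT⟩) h2
    rw [supported_eq_span_single] at h3
    refine (Submodule.span_le.2 ?_) h3
    rintro _ ⟨_, ⟨L, rfl, hL⟩, rfl⟩
    have hx := (mem_PC_iff x.1).1 x.2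
    obtain ⟨y, hy, rfl⟩ := exists_tuple (n := n + 1) (x.1 0) L (by simp [hL.length_eq])
    rw [← hy] at hL hx ⊢
    have hy' : y ∈ PC (n + 1) ℓ X := (mem_PC_iff y).2 ⟨hL.isChain hx.1, hL.pathLen_eq.trans hx.2⟩
    exact ⟨gen ℓ y, by rw [toLists_gen hy', List.ofFn_succ]⟩

end FullLists

/-! ### Thin chains -/

section ThinChains

open Finsupp

variable {X : Type u} [MetricSpace X] {n : ℕ} {ℓ : ℝ≥0}

/-- A tuple is thin if no point is strictly between consecutive entries, and no entry is strictly
between its neighbours. -/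
def ThinTuple (x : Fin (n + 1) → X) : Prop := Thin (x 0) (List.ofFn fun i => x i.succ)

/-- A cycle without thin chains is a boundary. -/
lemma Aligned.mem_boundaries (hX : Aligned X) {c : MC (n + 1) ℓ X}
    (hc : c ∈ cycles (n + 1) ℓ X) (h : ∀ x, ThinTuple x.1 → c x = 0) :
    c ∈ boundaries (n + 1) ℓ X := by
  have hc0 : boundary n ℓ X c = 0 := hc
  have h1 : toLists (n + 1) ℓ X c ∈ supported ℤ ℤ {T | ∃ a L, T = a :: L ∧ ¬ Thin a L} := by
    have h2 : c ∈ supported ℤ ℤ {x : PC (n + 1) ℓ X | ¬ ThinTuple x.1} := fun x hx h' =>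
      Finsupp.mem_support_iff.1 hx (h x h')
    have h3 := Submodule.mem_map_of_mem (f := toLists (n + 1) ℓ X) h2
    rw [toLists, lmapDomain_supported] at h3
    refine supported_mono ?_ h3
    rintro _ ⟨x, hx, rfl⟩
    exact ⟨_, _, List.ofFn_succ, hx⟩
  have h2 := hX.listBdry_listHtpy h1
  rw [← toLists_boundary, hc0, map_zero, map_zero, add_zero] at h2
  obtain ⟨b, hb⟩ := listHtpy_toLists_mem (n + 1) ℓ c
  exact ⟨b, toLists_injective _ _ (by rw [toLists_boundary, hb, h2])⟩

/-- Every term of a boundary arises by a deletion, hence is not thin. Coefficients at thin chains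
are therefore invariants of homology classes. -/
lemma apply_eq_zero_of_mem_boundaries {c : MC n ℓ X} (hc : c ∈ boundaries n ℓ X) (x : PC n ℓ X)
    (hx : ThinTuple x.1) : c x = 0 := by
  obtain ⟨b, rfl⟩ := hc
  have h1 : listBdry (toLists (n + 1) ℓ X b) ∈
      supported ℤ ℤ {T | ∃ a L, T = a :: L ∧ ¬ Thin a L} := by
    have : ∀ Y : List X →₀ ℤ, listBdry Y ∈
        supported ℤ ℤ {T | ∃ a L, T = a :: L ∧ ¬ Thin a L} := by
      intro Y
      induction Y using Finsupp.induction_linear with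
      | zero => simp
      | add f g hf hg => rw [map_add]; exact Submodule.add_mem _ hf hg
      | single L k =>
        rw [show single L k = k • single L (1 : ℤ) by simp, map_zsmul]
        refine Submodule.smul_mem _ _ ?_
        cases L with
        | nil => simp [listBdry]
        | cons a L =>
          rw [listBdry_single]
          exact consL_mem_supported (fun T hT => ⟨a, T, rfl, Deletion.not_thin hT⟩) (bdryAux_mem L a)
    exact this _
  rw [← toLists_boundary] at h1
  have h2 : toLists n ℓ X (boundary n ℓ X b) (List.ofFn x.1) = boundary n ℓ X b x :=
    mapDomain_apply (List.ofFn_injective.comp Subtype.val_injective) _ x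
  rw [← h2]
  by_contra h3
  obtain ⟨a, L, h4, h5⟩ := h1 (Finsupp.mem_support_iff.2 h3)
  rw [List.ofFn_succ, List.cons.injEq] at h4
  exact h5 (h4.1 ▸ h4.2 ▸ hx)

lemma ThinTuple.gen_mem_cycles {x : Fin (n + 1) → X} (h : ThinTuple x) :
    gen ℓ x ∈ cycles n ℓ X := by
  cases n with
  | zero => trivial
  | succ n =>
    by_cases hx : x ∈ PC (n + 1) ℓ X
    · refine toLists_injective n ℓ ?_
      rw [toLists_boundary, toLists_gen hx, List.ofFn_succ, listBdry_single,
        Thin.bdryAux_eq_zero h, map_zero, map_zero]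
    · rw [gen_of_notMem hx]
      exact Submodule.zero_mem _

lemma Adjacent.symm {a b : X} (h : Adjacent a b) : Adjacent b a := by
  refine ⟨h.1.symm, fun z hz => h.2 z ⟨?_, hz.2.2.symm, hz.2.1.symm⟩⟩
  have := hz.1
  unfold IsBetween at *
  rw [dist_comm a b, dist_comm a z, dist_comm z b]
  linarith

lemma Thin.innerBoundary_of_mem {L : List X} : ∀ {a b : X},
    List.IsChain (· ≠ ·) (a :: b :: L) → Thin a (b :: L) →
      ∀ z ∈ a :: b :: L, z ∈ innerBoundary X := by
  induction L with
  | nil =>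
    intro a b h1 h2 z hz
    have h3 : Adjacent a b := ⟨(List.isChain_cons_cons.1 h1).1, h2.1⟩
    simp only [List.mem_cons, List.not_mem_nil, or_false] at hz
    rcases hz with rfl | rfl
    exacts [⟨b, h3⟩, ⟨a, h3.symm⟩]
  | cons c L ih =>
    intro a b h1 h2 z hz
    rcases List.mem_cons.1 hz with rfl | hz
    · exact ⟨b, (List.isChain_cons_cons.1 h1).1, h2.1⟩
    · exact ih (List.isChain_cons_cons.1 h1).2 h2.2.2 z hz

lemma ThinTuple.mem_innerBoundary {x : Fin (n + 2) → X} (hp : IsProper x) (h : ThinTuple x)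
    (i : Fin (n + 2)) : x i ∈ innerBoundary X := by
  have h1 : List.ofFn x = x 0 :: x 1 :: List.ofFn fun i => x i.succ.succ := by
    rw [List.ofFn_succ, List.ofFn_succ]; rfl
  have h2 : (List.ofFn fun i => x i.succ) = x 1 :: List.ofFn fun i => x i.succ.succ := by
    rw [List.ofFn_succ]; rfl
  rw [isProper_iff_isChain, h1] at hp
  unfold ThinTuple at h
  rw [h2] at h
  refine Thin.innerBoundary_of_mem hp h (x i) ?_
  rw [← h1]
  exact List.mem_ofFn.2 ⟨i, rfl⟩

/-- The two neighbours of each interior entry coincide, and nothing is strictly between a point and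
itself. -/
lemma Adjacent.thin_alternating (n : ℕ) : ∀ {a b : X}, Adjacent a b →
    List.IsChain (· ≠ ·) (a :: alternating n a b) ∧ Thin a (alternating n a b) := by
  induction n with
  | zero => exact fun _ => ⟨List.isChain_singleton _, trivial⟩
  | succ n ih =>
    intro a b h
    obtain ⟨h1, h2⟩ := ih h.symm
    refine ⟨List.isChain_cons_cons.2 ⟨h.1, h1⟩, h.2, ?_, h2⟩
    intro c hc
    cases n with
    | zero => simp [alternating] at hc
    | succ n =>
      obtain rfl : a = c := by simpa [alternating] using hc
      exact not_strictlyBetween_self _ _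

lemma Adjacent.exists_thinTuple {a b : X} (h : Adjacent a b) (n : ℕ) :
    ∃ x : Fin (n + 1) → X, x 0 = a ∧ IsProper x ∧ ThinTuple x := by
  obtain ⟨h1, h2⟩ := h.thin_alternating n
  obtain ⟨x, rfl, hx⟩ := exists_tuple a (alternating n a b) (length_alternating n a b)
  refine ⟨x, rfl, ?_, ?_⟩
  · rwa [isProper_iff_isChain, List.ofFn_succ, hx]
  · rwa [ThinTuple, hx]

end ThinChains

/-! ### Maps on magnitude homology -/

section Maps

variable {X : Type u} {Y : Type v} [MetricSpace X] [MetricSpace Y] {f : X → Y} {g : Y → X}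

lemma map_comp_map_eq_id_iff (hf : LipschitzWith 1 f) (hg : LipschitzWith 1 g) (n : ℕ) :
    map g hg n ∘ₗ map f hf n = LinearMap.id ↔ ∀ ℓ, ∀ c ∈ cycles n ℓ X,
      chainMap g n ℓ (chainMap f n ℓ c) - c ∈ boundaries n ℓ X := by
  have key : ∀ ℓ (c : cycles n ℓ X), mapl g hg n ℓ (mapl f hf n ℓ (Submodule.Quotient.mk c)) =
      Submodule.Quotient.mk c ↔ chainMap g n ℓ (chainMap f n ℓ c) - c ∈ boundaries n ℓ X := by
    intro ℓ c
    exact Submodule.Quotient.eq _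
  constructor
  · intro h ℓ c hc
    refine (key ℓ ⟨c, hc⟩).1 ?_
    have h1 := LinearMap.congr_fun h (DirectSum.lof ℤ ℝ≥0 (fun ℓ => MHl n ℓ X) ℓ
      (Submodule.Quotient.mk ⟨c, hc⟩))
    simp only [map, LinearMap.comp_apply, DirectSum.lmap_lof, LinearMap.id_apply] at h1
    exact DirectSum.of_injective ℓ h1
  · intro h
    refine DirectSum.linearMap_ext ℤ fun ℓ => LinearMap.ext fun q => ?_
    obtain ⟨c, rfl⟩ := Submodule.Quotient.mk_surjective _ q
    simp only [map, LinearMap.comp_apply, DirectSum.lmap_lof, LinearMap.id_apply]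
    rw [(key ℓ c).2 (h ℓ c c.2)]

/-- Split a cycle into its thin part, which $g_\#f_\#$ fixes entrywise, and the rest, which is a
cycle without thin chains and hence a boundary. -/
lemma Aligned.map_comp_map_eq_id (hX : Aligned X) (hf : LipschitzWith 1 f)
    (hg : LipschitzWith 1 g) (h : ∀ x ∈ innerBoundary X, g (f x) = x) {n : ℕ} (hn : 1 ≤ n) :
    map g hg n ∘ₗ map f hf n = LinearMap.id := by
  classical
  obtain ⟨n, rfl⟩ := Nat.exists_eq_add_of_le' hn
  rw [map_comp_map_eq_id_iff]
  intro ℓ c hc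
  set t := c.filter fun x => ThinTuple x.1 with ht
  set r := c.filter fun x => ¬ ThinTuple x.1 with hr
  have hc' : c = t + r := (Finsupp.filter_add_filter_not c _).symm
  have ht' : t ∈ Submodule.span ℤ {z : MC (n + 1) ℓ X | ∃ x ∈ PC (n + 1) ℓ X, ThinTuple x ∧
      z = gen ℓ x} := by
    rw [← Finsupp.sum_single t]
    refine Submodule.sum_mem _ fun x hx => ?_
    rw [← mul_one (t x), ← smul_eq_mul, ← Finsupp.smul_single, ← gen_of_mem x.2]
    refine Submodule.smul_mem _ _ (Submodule.subset_span ⟨x.1, x.2, ?_, rfl⟩)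
    by_contra h'
    exact Finsupp.mem_support_iff.1 hx (Finsupp.filter_apply_neg _ _ h')
  have ht1 : t ∈ cycles (n + 1) ℓ X := by
    refine (Submodule.span_le.2 ?_) ht'
    rintro _ ⟨x, -, hx, rfl⟩
    exact hx.gen_mem_cycles
  have ht2 : chainMap g (n + 1) ℓ (chainMap f (n + 1) ℓ t) = t := by
    refine LinearMap.eqOn_span (f := chainMap g (n + 1) ℓ ∘ₗ chainMap f (n + 1) ℓ)
      (g := LinearMap.id) ?_ ht'
    rintro _ ⟨x, hx, hx', rfl⟩
    -- `Small` is stable under 1-Lipschitz maps, so the composite can be computed before knowing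
    -- that $f$ preserves the length of $x$.
    have hs : Small ℓ x := Or.inr hx
    rw [LinearMap.comp_apply, chainMap_gen hf hs, chainMap_gen hg (hs.map hf), LinearMap.id_apply]
    congr 1
    exact funext fun i => h _ (hx'.mem_innerBoundary hx.1 i)
  have hr1 : r ∈ boundaries (n + 1) ℓ X := by
    refine hX.mem_boundaries ?_ fun x hx => Finsupp.filter_apply_neg _ _ (not_not.2 hx)
    rw [hc'] at hc
    simpa using Submodule.sub_mem _ hc ht1
  have hr2 := chainMap_mem_boundaries hg _ _ _ (chainMap_mem_boundaries hf _ _ _ hr1)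
  rw [hc', map_add, map_add, ht2, add_sub_add_left_eq_sub]
  exact Submodule.sub_mem _ hr2 hr1

/-- Test on a thin chain $x$ starting at $a$. The coefficient of $x$ in the boundary $g_\#f_\#x-x$
is 0, so $gfx=x$. -/
lemma Aligned.apply_mem_innerBoundary (hY : Aligned Y) (hf : LipschitzWith 1 f)
    (hg : LipschitzWith 1 g) {n : ℕ} (hn : 1 ≤ n)
    (h : map g hg n ∘ₗ map f hf n = LinearMap.id) {a : X} (ha : a ∈ innerBoundary X) :
    g (f a) = a ∧ f a ∈ innerBoundary Y := by
  obtain ⟨n, rfl⟩ := Nat.exists_eq_add_of_le' hn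
  rw [map_comp_map_eq_id_iff] at h
  obtain ⟨b, hab⟩ := ha
  obtain ⟨x, rfl, hp, ht⟩ := hab.exists_thinTuple (n + 1)
  obtain ⟨ℓ, hℓ⟩ : ∃ ℓ : ℝ≥0, len x = ℓ := ⟨⟨len x, len_nonneg x⟩, rfl⟩
  have hx : x ∈ PC (n + 1) ℓ X := ⟨hp, hℓ⟩
  have hs : Small ℓ x := Or.inr hx
  have h1 := h ℓ (gen ℓ x) ht.gen_mem_cycles
  have hne : gen ℓ x ∉ boundaries (n + 1) ℓ X := by
    intro h'
    have := apply_eq_zero_of_mem_boundaries h' ⟨x, hx⟩ ht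
    rw [gen_of_mem hx, Finsupp.single_eq_same] at this
    exact one_ne_zero this
  constructor
  · have h2 := apply_eq_zero_of_mem_boundaries h1 ⟨x, hx⟩ ht
    rw [chainMap_gen hf hs, chainMap_gen hg (hs.map hf), Finsupp.sub_apply, gen_of_mem hx,
      Finsupp.single_eq_same] at h2
    by_contra h3
    have h4 : gen ℓ (g ∘ f ∘ x) ⟨x, hx⟩ = 0 := by
      by_cases h5 : g ∘ f ∘ x ∈ PC (n + 1) ℓ X
      · rw [gen_of_mem h5, Finsupp.single_eq_of_ne]
        exact fun h6 => h3 (congrFun (congrArg Subtype.val h6) 0).symm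
      · rw [gen_of_notMem h5]; rfl
    rw [h4] at h2
    norm_num at h2
  · have h3 : chainMap f (n + 1) ℓ (gen ℓ x) ∉ boundaries (n + 1) ℓ Y := by
      intro h2
      refine hne ?_
      simpa using Submodule.sub_mem _ (chainMap_mem_boundaries hg _ _ _ h2) h1
    have h4 := chainMap_mem_cycles hf _ _ _ (ht.gen_mem_cycles (ℓ := ℓ))
    rw [chainMap_gen hf hs] at h3 h4
    have h5 : f ∘ x ∈ PC (n + 1) ℓ Y := by
      by_contra h5
      rw [gen_of_notMem h5] at h3
      exact h3 (Submodule.zero_mem _)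
    -- Were $fx$ not thin, it would be a boundary in $Y$, and then so would $x$ in $X$.
    have h6 : ThinTuple (f ∘ x) := by
      by_contra h6
      refine h3 (hY.mem_boundaries h4 fun y hy => ?_)
      rw [gen_of_mem h5, Finsupp.single_eq_of_ne]
      rintro rfl
      exact h6 hy
    exact h6.mem_innerBoundary h5.1 0

end Maps

end MagnitudeHomology

end

theorem theorem6p6 {X : Type*} {Y : Type*} [MetricSpace X] [MetricSpace Y]
    (hX : MagnitudeHomology.Aligned X) (hY : MagnitudeHomology.Aligned Y)
    (f : X → Y) (g : Y → X) (hf : LipschitzWith 1 f) (hg : LipschitzWith 1 g) :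
    List.TFAE [
      ∀ n : ℕ, 1 ≤ n →
        MagnitudeHomology.map g hg n ∘ₗ MagnitudeHomology.map f hf n = LinearMap.id ∧
        MagnitudeHomology.map f hf n ∘ₗ MagnitudeHomology.map g hg n = LinearMap.id,
      ∃ n : ℕ, 1 ≤ n ∧
        MagnitudeHomology.map g hg n ∘ₗ MagnitudeHomology.map f hf n = LinearMap.id ∧
        MagnitudeHomology.map f hf n ∘ₗ MagnitudeHomology.map g hg n = LinearMap.id,
      ∃ e : MagnitudeHomology.innerBoundary X ≃ᵢ MagnitudeHomology.innerBoundary Y,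
        (∀ x, (e x : Y) = f x) ∧ ∀ y, (e.symm y : X) = g y] := by
  tfae_have 1 → 2 := fun h => ⟨1, le_rfl, h 1 le_rfl⟩
  tfae_have 2 → 3 := by
    rintro ⟨n, hn, h1, h2⟩
    have hX' := fun {a} => hY.apply_mem_innerBoundary hf hg hn h1 (a := a)
    have hY' := fun {a} => hX.apply_mem_innerBoundary hg hf hn h2 (a := a)
    refine ⟨⟨⟨fun x => ⟨f x, (hX' x.2).2⟩, fun y => ⟨g y, (hY' y.2).2⟩,
      fun x => Subtype.ext (hX' x.2).1, fun y => Subtype.ext (hY' y.2).1⟩,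
      Isometry.of_dist_eq fun x y => le_antisymm ?_ ?_⟩, fun _ => rfl, fun _ => rfl⟩
    · simpa [Subtype.dist_eq] using hf.dist_le_mul x.1 y.1
    -- Since $gf$ fixes both points, the Lipschitz bound for $g$ is the reverse inequality for $f$.
    · have := hg.dist_le_mul (f x) (f y)
      rw [(hX' x.2).1, (hX' y.2).1] at this
      simpa [Subtype.dist_eq] using this
  tfae_have 3 → 1 := by
    rintro ⟨e, h1, h2⟩ n hn
    refine ⟨hX.map_comp_map_eq_id hf hg (fun x hx => ?_) hn,
      hY.map_comp_map_eq_id hg hf (fun y hy => ?_) hn⟩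
    · rw [← h1 ⟨x, hx⟩, ← h2, e.symm_apply_apply]
    · rw [← h2 ⟨y, hy⟩, ← h1, e.apply_symm_apply]
  tfae_finish
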